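/- Let $T>0$ and let $\gamma:\mathbb{R}\to\mathbb{R}$ be a $T$-periodic function of class $C^1$. Write $\overline{\gamma}=\frac1T\int_0^T\gamma(t)\,dt$ and $\widehat\gamma=\gamma-\overline\gamma$. Let $C^1_T$ be the space of $T$-periodic $C^1$ functions $\mathbb{R}\to\mathbb{R}$ and $C^1_{T,0}$ its subspace of functions with zero average. Define \[ \underline{\mu}[\gamma](p)=-\max_{t\in[0,T]}\bigl\{p(t)^2+\widehat\gamma(t)-p'(t)\bigr\}\quad(p\in C^1_T), \] \[ \overline{\mu}[\gamma](q)=\Bigl(\int_0^T e^{-2\int_0^t q(s)\,ds}\,dt\Bigr)^{-1}\int_0^T e^{-2\int_0^t q(s)\,ds}\bigl(q(t)^2-\widehat\gamma(t)\bigr)\,dt\quad(q\in C^1_{T,0}). \] A limit cycle of $x'=x^2+\gamma(t)$ is an isolated $T$-periodic solution $\phi$, that is, a $T$-periodic solution such that no other $T$-periodic solution has an initial value at $t=0$ close to $\phi(0)$. Let $d(x_0)=x(T;x_0)-x_0$ be the displacement map, where $x(\cdot\,;x_0)$ is the solution with $x(0;x_0)=x_0$. A limit cycle $\phi$ is hyperbolic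 if $\phi(0)$ is a simple zero of $d$, and double if $\phi(0)$ is a zero of $d$ of multiplicity two. It is semi-stable if the nearby solutions on one side of $\phi$ are asymptotic to $\phi$ as $t\to+\infty$ and those on the other side are asymptotic to $\phi$ as $t\to-\infty$. Then the maximum of $\underline\mu[\gamma]$ over $C^1_T$ and the minimum of $\overline\mu[\gamma]$ over $C^1_{T,0}$ exist and coincide. Let $\gamma^*$ be their common value and $\Delta_\gamma=\gamma^*-\overline\gamma$. The differential equation \[ x'=x^2+\gamma(t) \] has exactly two limit cycles, both hyperbolic, if $\Delta_\gamma>0$; it has a unique limit cycle, which is semi-stable and double, if $\Delta_\gamma=0$; and it has no limit cycles if $\Delta_\gamma<0$. Moreover, \[ \underline{\mu}[\gamma](p)-\overline\gamma\le\Delta_\gamma\le\overline{\mu}[\gamma](q)-\overline\gamma \] for every $p\in C^1_T$ and every $q\in C^1_{T,0}$. -/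

import Mathlib

namespace RiccatiEq

noncomputable section

/-! ### Scalar `T`-periodic differential equations `x' = f(t, x)` -/

/-- `x` solves `x' = f(t, x)` on the set of times `s` (one-sided derivatives at end points). -/
def IsSolutionOn (f : ℝ → ℝ → ℝ) (x : ℝ → ℝ) (s : Set ℝ) : Prop :=
  ∀ t ∈ s, HasDerivWithinAt x (f t (x t)) s t

/-- `φ` is a `T`-periodic solution of `x' = f(t, x)`, defined for all times. -/
def IsPeriodicSolution (f : ℝ → ℝ → ℝ) (T : ℝ) (φ : ℝ → ℝ) : Prop :=
  Function.Periodic φ T ∧ IsSolutionOn f φ Set.univ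

/-- A limit cycle is an isolated periodic solution: no other periodic solution
has an initial value close to that of `φ`. -/
def IsLimitCycle (f : ℝ → ℝ → ℝ) (T : ℝ) (φ : ℝ → ℝ) : Prop :=
  IsPeriodicSolution f T φ ∧
    ∃ ε > 0, ∀ ψ, IsPeriodicSolution f T ψ → |ψ 0 - φ 0| < ε → ψ = φ

open Classical in
/-- The Poincaré map `x₀ ↦ x(T; x₀)`, where `x(·; x₀)` is the solution with `x(0; x₀) = x₀`.
It is meaningful for those `x₀` whose solution is defined on `[0, T]`; elsewhere the value is `0`. -/
def poincareMap (f : ℝ → ℝ → ℝ) (T : ℝ) (x₀ : ℝ) : ℝ :=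
  if h : ∃ x : ℝ → ℝ, x 0 = x₀ ∧ IsSolutionOn f x (Set.Icc 0 T) then h.choose T else 0

/-- The displacement map: the Poincaré map at time `T` minus the identity. -/
def displacement (f : ℝ → ℝ → ℝ) (T : ℝ) (x₀ : ℝ) : ℝ :=
  poincareMap f T x₀ - x₀

/-- `x₀` is a zero of multiplicity exactly `n` of `d`. -/
def IsZeroOfMultiplicity (d : ℝ → ℝ) (n : ℕ) (x₀ : ℝ) : Prop :=
  ContDiffAt ℝ n d x₀ ∧ (∀ k < n, iteratedDeriv k d x₀ = 0) ∧ iteratedDeriv n d x₀ ≠ 0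

/-- A limit cycle of multiplicity `n`. -/
def HasMultiplicity (f : ℝ → ℝ → ℝ) (T : ℝ) (φ : ℝ → ℝ) (n : ℕ) : Prop :=
  IsZeroOfMultiplicity (displacement f T) n (φ 0)

/-- `φ` is hyperbolic: the corresponding zero of the displacement map is simple. -/
def IsHyperbolic (f : ℝ → ℝ → ℝ) (T : ℝ) (φ : ℝ → ℝ) : Prop :=
  HasMultiplicity f T φ 1

/-- `φ` is double: the corresponding zero of the displacement map has multiplicity two. -/
def IsDouble (f : ℝ → ℝ → ℝ) (T : ℝ) (φ : ℝ → ℝ) : Prop :=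
  HasMultiplicity f T φ 2

/-- The solution starting at time `0` from `x₀` is asymptotic to `φ` as `t → +∞`. -/
def ForwardAsymptotic (f : ℝ → ℝ → ℝ) (φ : ℝ → ℝ) (x₀ : ℝ) : Prop :=
  ∃ x : ℝ → ℝ, x 0 = x₀ ∧ IsSolutionOn f x (Set.Ici 0) ∧
    Filter.Tendsto (fun t => x t - φ t) Filter.atTop (nhds 0)

/-- The solution starting at time `0` from `x₀` is asymptotic to `φ` as `t → -∞`. -/
def BackwardAsymptotic (f : ℝ → ℝ → ℝ) (φ : ℝ → ℝ) (x₀ : ℝ) : Prop :=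
  ∃ x : ℝ → ℝ, x 0 = x₀ ∧ IsSolutionOn f x (Set.Iic 0) ∧
    Filter.Tendsto (fun t => x t - φ t) Filter.atBot (nhds 0)

/-- `φ` is semi-stable: the nearby solutions on one side of `φ` are attracted by it (they approach
it as `t → +∞`) and those on the other side are repelled (they approach it as `t → -∞`). -/
def IsSemistable (f : ℝ → ℝ → ℝ) (φ : ℝ → ℝ) : Prop :=
  ∃ δ > 0,
    ((∀ x₀ ∈ Set.Ioo (φ 0 - δ) (φ 0), ForwardAsymptotic f φ x₀) ∧
      (∀ x₀ ∈ Set.Ioo (φ 0) (φ 0 + δ), BackwardAsymptotic f φ x₀)) ∨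
    ((∀ x₀ ∈ Set.Ioo (φ 0 - δ) (φ 0), BackwardAsymptotic f φ x₀) ∧
      (∀ x₀ ∈ Set.Ioo (φ 0) (φ 0 + δ), ForwardAsymptotic f φ x₀))

/-! ### The Riccati equation and its discriminant -/

/-- The right-hand side of `x' = x² + γ(t)`. -/
def riccati (γ : ℝ → ℝ) (t x : ℝ) : ℝ := x ^ 2 + γ t

/-- The average over a period. -/
def mean (T : ℝ) (γ : ℝ → ℝ) : ℝ := 1 / T * ∫ t in (0 : ℝ)..T, γ t

/-- The mean-centered function. -/
def centered (T : ℝ) (γ : ℝ → ℝ) (t : ℝ) : ℝ := γ t - mean T γ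

/-- The space of `T`-periodic `C¹` real functions. -/
def C1T (T : ℝ) : Set (ℝ → ℝ) := {p | ContDiff ℝ 1 p ∧ Function.Periodic p T}

/-- The space of `T`-periodic `C¹` real functions with zero average. -/
def C1T0 (T : ℝ) : Set (ℝ → ℝ) := {p | p ∈ C1T T ∧ mean T p = 0}

/-- The functional `p ↦ -max_{t ∈ [0,T]} (p(t)² + γ̂(t) - p'(t))`. -/
def muLower (T : ℝ) (γ p : ℝ → ℝ) : ℝ :=
  -sSup ((fun t => p t ^ 2 + centered T γ t - deriv p t) '' Set.Icc 0 T)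

/-- The weight `exp(-2 ∫₀ᵗ p)`. -/
def weight (p : ℝ → ℝ) (t : ℝ) : ℝ := Real.exp (-2 * ∫ s in (0 : ℝ)..t, p s)

/-- The weighted average of `p² - γ̂` with respect to the weight `exp(-2 ∫₀ᵗ p)`. -/
def muUpper (T : ℝ) (γ p : ℝ → ℝ) : ℝ :=
  (∫ t in (0 : ℝ)..T, weight p t)⁻¹ *
    ∫ t in (0 : ℝ)..T, weight p t * (p t ^ 2 - centered T γ t)

/-- The number `γ*`, the maximum of `muLower T γ` over all `T`-periodic `C¹` functions. -/
def gammaStar (T : ℝ) (γ : ℝ → ℝ) : ℝ := sSup (muLower T γ '' C1T T)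

/-- The discriminant `Δ_γ = γ* - mean γ`. -/
def discriminant (T : ℝ) (γ : ℝ → ℝ) : ℝ := gammaStar T γ - mean T γ

end

end RiccatiEq

/-!
For a `T`-periodic `p` and a `q` of mean zero, `(weight q * p)'` integrates to zero over a period.
Adding it to the integrand of `muUpper q` completes the square `(q - p) ^ 2`, which gives the weak
duality `muLower p ≤ muUpper q`.

Let `c` be the largest constant for which `x' = x² + γ̂ + c` has a periodic solution `φ`. Then `φ`
has mean zero: otherwise the linearized equation is solvable with forcing `1`, and moving `φ` along
that solution gives a strict supersolution for a slightly larger constant. Both functionals take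
the value `c` at `φ`, so there is no duality gap and `c = γ*`.

Relative to a periodic solution `ψ` of `x' = x² + γ`, the substitution `x = ψ + 1 / y` makes the
equation linear, so the Poincaré map is an explicit Möbius map. Besides `ψ 0` it has exactly one
other fixed point, and the two collide precisely when `ψ` has mean zero.
-/

namespace RiccatiEq

open Set Filter Topology Function
open scoped NNReal

section Solutions

variable {f : ℝ → ℝ → ℝ} {x : ℝ → ℝ} {s : Set ℝ} {c d : ℝ}

theorem IsSolutionOn.hasDerivAt (hx : IsSolutionOn f x univ) (t : ℝ) :
    HasDerivAt x (f t (x t)) t :=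
  (hx t (mem_univ t)).hasDerivAt univ_mem

theorem IsSolutionOn.continuous (hx : IsSolutionOn f x univ) : Continuous x :=
  continuous_iff_continuousAt.2 fun t => (hx.hasDerivAt t).continuousAt

theorem IsSolutionOn.mono {u : Set ℝ} (hx : IsSolutionOn f x s) (hus : u ⊆ s) :
    IsSolutionOn f x u :=
  fun t ht => (hx t (hus ht)).mono hus

theorem IsSolutionOn.continuousOn (hx : IsSolutionOn f x s) : ContinuousOn x s :=
  fun t ht => (hx t ht).continuousWithinAt

theorem IsSolutionOn.hasDerivWithinAt_Ici (hx : IsSolutionOn f x (Icc c d)) {t : ℝ}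
    (ht : t ∈ Ico c d) : HasDerivWithinAt x (f t (x t)) (Ici t) t :=
  (hx t (Ico_subset_Icc_self ht)).mono_of_mem_nhdsWithin (Icc_mem_nhdsGE_of_mem ht)

theorem IsSolutionOn.le_supersolution (hx : IsSolutionOn f x (Icc c d)) {β β' : ℝ → ℝ}
    (hβ : ∀ t, HasDerivAt β (β' t) t) (hlt : ∀ t ∈ Icc c d, f t (β t) < β' t)
    (hc : x c ≤ β c) : ∀ t ∈ Icc c d, x t ≤ β t :=
  image_le_of_deriv_right_lt_deriv_boundary' hx.continuousOn (fun _ => hx.hasDerivWithinAt_Ici) hc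
    (fun t _ => (hβ t).continuousAt.continuousWithinAt) (fun t _ => (hβ t).hasDerivWithinAt)
    fun t ht hxβ => hxβ ▸ hlt t (Ico_subset_Icc_self ht)

theorem IsSolutionOn.subsolution_le (hx : IsSolutionOn f x (Icc c d)) {α α' : ℝ → ℝ}
    (hα : ∀ t, HasDerivAt α (α' t) t) (hlt : ∀ t ∈ Icc c d, α' t < f t (α t))
    (hc : α c ≤ x c) : ∀ t ∈ Icc c d, α t ≤ x t :=
  image_le_of_deriv_right_lt_deriv_boundary'
    (fun t _ => (hα t).continuousAt.continuousWithinAt) (fun t _ => (hα t).hasDerivWithinAt) hc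
    hx.continuousOn (fun _ => hx.hasDerivWithinAt_Ici)
    fun t ht hαx => hαx ▸ hlt t (Ico_subset_Icc_self ht)

end Solutions

section Extension

variable {f : ℝ → ℝ → ℝ} {T : ℝ}

theorem periodic_intervalIntegral {g : ℝ → ℝ} (hg : Continuous g) (hper : Periodic g T)
    (h0 : ∫ s in (0 : ℝ)..T, g s = 0) : Periodic (fun t => ∫ s in (0 : ℝ)..t, g s) T := fun t => by
  simpa [h0] using hper.intervalIntegral_add_eq_add 0 t fun _ _ => hg.intervalIntegrable _ _

theorem exists_continuous_periodic_eqOn {h : ℝ → ℝ} (hT : 0 < T) (hc : ContinuousOn h (Icc 0 T))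
    (h0 : h 0 = h T) : ∃ g, Continuous g ∧ Periodic g T ∧ EqOn g h (Icc 0 T) := by
  have : Fact (0 < T) := ⟨hT⟩
  let g : ℝ → ℝ := fun t => AddCircle.liftIco T 0 h t
  have hper : Periodic g T := fun t => by simp [g]
  have hIco : ∀ t ∈ Ico 0 T, g t = h t := fun t ht => AddCircle.liftIco_zero_coe_apply ht
  refine ⟨g, (AddCircle.liftIco_zero_continuous h0 hc).comp (AddCircle.continuous_mk' T), hper,
    fun t ht => ?_⟩
  rcases ht.2.eq_or_lt with rfl | htT
  · rw [← h0, ← hIco 0 ⟨le_rfl, hT⟩, hper.eq]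
  · exact hIco t ⟨ht.1, htT⟩

theorem exists_isPeriodicSolution_of_eq (hT : 0 < T) (hf : Continuous (uncurry f))
    (hper : Periodic f T) {x : ℝ → ℝ} (hx : IsSolutionOn f x (Icc 0 T))
    (hxT : x T = x 0) : ∃ φ, IsPeriodicSolution f T φ ∧ φ 0 = x 0 := by
  obtain ⟨g, hg, hgper, hgf⟩ := exists_continuous_periodic_eqOn hT (h := fun t => f t (x t))
    (hf.comp_continuousOn (continuousOn_id.prodMk hx.continuousOn))
    (by rw [hxT, hper.eq])
  have hint : ∀ t ∈ Icc 0 T, ∫ s in (0 : ℝ)..t, g s = x t - x 0 := fun t ht =>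
    intervalIntegral.integral_eq_sub_of_hasDeriv_right_of_le ht.1
      (hx.continuousOn.mono (Icc_subset_Icc_right ht.2))
      (fun s hs => by
        have hs' : s ∈ Ico 0 T := ⟨hs.1.le, hs.2.trans_le ht.2⟩
        rw [hgf (Ico_subset_Icc_self hs')]
        exact (hx.hasDerivWithinAt_Ici hs').mono Ioi_subset_Ici_self)
      (hg.intervalIntegrable _ _)
  let φ : ℝ → ℝ := fun t => x 0 + ∫ s in (0 : ℝ)..t, g s
  have hφper : Periodic φ T := fun t => congrArg (x 0 + ·)
    (periodic_intervalIntegral hg hgper (by rw [hint T ⟨hT.le, le_rfl⟩, hxT, sub_self]) t)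
  have hgφ : ∀ t, g t = f t (φ t) := fun t => by
    have hdiff : Periodic (fun t => g t - f t (φ t)) T := fun t => by
      simp only [hgper t, hφper t, hper t]
    obtain ⟨s, hs, hst⟩ := hdiff.exists_mem_Ico₀ hT t
    have hs' := Ico_subset_Icc_self hs
    have hφs : φ s = x s := by simp [φ, hint s hs']
    rw [hφs, hgf hs', sub_self] at hst
    exact sub_eq_zero.1 hst
  refine ⟨φ, ⟨hφper, fun t _ => ?_⟩, by simp [φ]⟩
  rw [← hgφ]
  exact ((hg.integral_hasStrictDerivAt 0 t).hasDerivAt.const_add _).hasDerivWithinAt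

end Extension

section ClampedField

variable {f : ℝ → ℝ → ℝ} {T a b : ℝ} {hab : a ≤ b} {L : ℝ≥0}

/-- The field `f` with its space variable clamped to `[a, b]`. It is globally Lipschitz and bounded
when `f` is Lipschitz on `[a, b]`, so that its solutions do not blow up, and it has the same
solutions as `f` among the functions with values in `[a, b]`. -/
noncomputable def clampedField (hab : a ≤ b) (f : ℝ → ℝ → ℝ) (t y : ℝ) : ℝ :=
  f t (projIcc a b hab y)

theorem clampedField_of_mem {y : ℝ} (hy : y ∈ Icc a b) (t : ℝ) :
    clampedField hab f t y = f t y := by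
  rw [clampedField, projIcc_of_mem hab hy]

theorem lipschitzWith_clampedField {t : ℝ} (hf : LipschitzOnWith L (f t) (Icc a b)) :
    LipschitzWith L (clampedField hab f t) :=
  mul_one L ▸ hf.to_restrict.comp (LipschitzWith.projIcc hab)

theorem IsSolutionOn.of_clampedField {x : ℝ → ℝ} {s : Set ℝ}
    (hx : IsSolutionOn (clampedField hab f) x s) (hmem : ∀ t ∈ s, x t ∈ Icc a b) :
    IsSolutionOn f x s :=
  fun t ht => (hx t ht).congr_deriv (clampedField_of_mem (hmem t ht) t)

theorem exists_flow_clampedField (hab : a ≤ b) (hT : 0 ≤ T) (hf : Continuous (uncurry f))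
    (hL : ∀ t, LipschitzOnWith L (f t) (Icc a b)) :
    ∃ α : ℝ → ℝ → ℝ,
      (∀ y ∈ Icc a b, α y 0 = y ∧ IsSolutionOn (clampedField hab f) (α y) (Icc 0 T)) ∧
        ContinuousOn (fun y => α y T) (Icc a b) := by
  obtain ⟨M, hM⟩ := (isCompact_Icc.prod isCompact_Icc).exists_bound_of_continuousOn
    (s := Icc 0 T ×ˢ Icc a b) hf.continuousOn
  have hM0 : 0 ≤ M := (norm_nonneg _).trans (hM (0, a) ⟨⟨le_rfl, hT⟩, ⟨le_rfl, hab⟩⟩)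
  lift M to ℝ≥0 using hM0
  lift T to ℝ≥0 using hT
  obtain ⟨r, hr⟩ : ∃ r : ℝ≥0, (r : ℝ) = (b - a) / 2 := CanLift.prf _ (by linarith)
  have hball : Metric.closedBall ((a + b) / 2) r = Icc a b := by rw [hr, ← Real.Icc_eq_closedBall]
  have hpl : IsPicardLindelof (clampedField hab f) (tmin := 0) (tmax := T) ⟨0, le_rfl, T.2⟩
      ((a + b) / 2) (M * T + r) r M L :=
    { lipschitzOnWith := fun t _ => (lipschitzWith_clampedField (hL t)).lipschitzOnWith
      continuousOn := fun _ _ =>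
        (hf.comp (continuous_id.prodMk continuous_const)).continuousOn
      norm_le := fun t ht y _ => hM (t, projIcc a b hab y) ⟨ht, (projIcc a b hab y).2⟩
      mul_max_le := by simp }
  obtain ⟨α, hα, L', hLip⟩ := hpl.exists_forall_mem_closedBall_eq_hasDerivWithinAt_lipschitzOnWith
  rw [hball] at hα hLip
  exact ⟨α, hα, (hLip T ⟨T.2, le_rfl⟩).continuousOn⟩

end ClampedField

section PeriodicExistence

variable {f : ℝ → ℝ → ℝ} {T a b : ℝ} {L : ℝ≥0}

theorem exists_isPeriodicSolution_of_subsolution_of_supersolution (hT : 0 < T)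
    (hf : Continuous (uncurry f)) (hper : Periodic f T)
    (hL : ∀ t, LipschitzOnWith L (f t) (Icc a b)) {α α' β β' : ℝ → ℝ}
    (hα : ∀ t, HasDerivAt α (α' t) t) (hβ : ∀ t, HasDerivAt β (β' t) t)
    (hαmem : ∀ t ∈ Icc 0 T, α t ∈ Icc a b) (hβmem : ∀ t ∈ Icc 0 T, β t ∈ Icc a b)
    (hαlt : ∀ t ∈ Icc 0 T, α' t < f t (α t)) (hβlt : ∀ t ∈ Icc 0 T, f t (β t) < β' t)
    (hαT : α 0 ≤ α T) (hβT : β T ≤ β 0) (hαβ : α 0 ≤ β 0) :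
    ∃ φ, IsPeriodicSolution f T φ := by
  have h0 : (0 : ℝ) ∈ Icc 0 T := ⟨le_rfl, hT.le⟩
  have hab : a ≤ b := (hαmem 0 h0).1.trans (hαmem 0 h0).2
  obtain ⟨flow, hflow, hcont⟩ := exists_flow_clampedField hab hT.le hf hL
  have hsub : Icc (α 0) (β 0) ⊆ Icc a b := Icc_subset_Icc (hαmem 0 h0).1 (hβmem 0 h0).2
  have hinv : ∀ y ∈ Icc (α 0) (β 0), ∀ t ∈ Icc 0 T, flow y t ∈ Icc (α t) (β t) := by
    intro y hy t ht
    obtain ⟨hy0, hsol⟩ := hflow y (hsub hy)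
    exact ⟨hsol.subsolution_le hα
        (fun s hs => by rw [clampedField_of_mem (hαmem s hs)]; exact hαlt s hs)
        (hy0.symm ▸ hy.1) t ht,
      hsol.le_supersolution hβ
        (fun s hs => by rw [clampedField_of_mem (hβmem s hs)]; exact hβlt s hs)
        (hy0.symm ▸ hy.2) t ht⟩
  obtain ⟨y, hy, hfix⟩ := exists_mem_Icc_isFixedPt_of_mapsTo (hcont.mono hsub) hαβ
    fun y hy => Icc_subset_Icc hαT hβT (hinv y hy T ⟨hT.le, le_rfl⟩)
  obtain ⟨hy0, hsol⟩ := hflow y (hsub hy)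
  obtain ⟨φ, hφ, -⟩ := exists_isPeriodicSolution_of_eq hT hf hper
    (hsol.of_clampedField fun t ht =>
      Icc_subset_Icc (hαmem t ht).1 (hβmem t ht).2 (hinv y hy t ht)) (hfix.trans hy0.symm)
  exact ⟨φ, hφ⟩

theorem IsSolutionOn.tendsto_of_tendsto_field {x : ℕ → ℝ → ℝ} {y : ℝ → ℝ}
    {F : ℕ → ℝ → ℝ → ℝ} {ε : ℕ → ℝ} (hy : IsSolutionOn f y (Icc a b))
    (hL : ∀ t, LipschitzWith L (f t)) (hx : ∀ n, IsSolutionOn (F n) (x n) (Icc a b))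
    (hF : ∀ n, ∀ t ∈ Icc a b, dist (F n t (x n t)) (f t (x n t)) ≤ ε n)
    (hε : Tendsto ε atTop (𝓝 0)) (hxa : Tendsto (fun n => x n a) atTop (𝓝 (y a))) :
    ∀ t ∈ Icc a b, Tendsto (fun n => x n t) atTop (𝓝 (y t)) := by
  intro t ht
  have hgronwall : ∀ n, dist (x n t) (y t) ≤ gronwallBound (dist (x n a) (y a)) L (ε n) (t - a) :=
    fun n => by
      simpa using dist_le_of_approx_trajectories_ODE hL (hx n).continuousOn
        (fun _ => (hx n).hasDerivWithinAt_Ici) (fun s hs => hF n s (Ico_subset_Icc_self hs))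
        hy.continuousOn (fun _ => hy.hasDerivWithinAt_Ici) (fun _ _ => (dist_self _).le) le_rfl t ht
  have hbound : Tendsto (fun n => gronwallBound (dist (x n a) (y a)) L (ε n) (t - a)) atTop
      (𝓝 0) := by
    have := (tendsto_iff_dist_tendsto_zero.1 hxa)
    rcases eq_or_ne L 0 with rfl | hL0
    · simp only [NNReal.coe_zero, gronwallBound_K0]
      simpa using this.add (hε.mul_const _)
    · simp only [gronwallBound_of_K_ne_0 (NNReal.coe_ne_zero.2 hL0)]
      simpa using (this.mul_const _).add ((hε.div_const _).mul_const _)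
  exact tendsto_iff_dist_tendsto_zero.2 (squeeze_zero (fun _ => dist_nonneg) hgronwall hbound)

theorem exists_isPeriodicSolution_of_tendsto (hT : 0 < T) (hf : Continuous (uncurry f))
    (hper : Periodic f T) (hL : ∀ t, LipschitzOnWith L (f t) (Icc a b))
    {x : ℕ → ℝ → ℝ} {F : ℕ → ℝ → ℝ → ℝ} {ε : ℕ → ℝ} (hx : ∀ n, IsPeriodicSolution (F n) T (x n))
    (hmem : ∀ n t, x n t ∈ Icc a b) (hF : ∀ n t, dist (F n t (x n t)) (f t (x n t)) ≤ ε n)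
    (hε : Tendsto ε atTop (𝓝 0)) : ∃ φ, IsPeriodicSolution f T φ := by
  have hab : a ≤ b := (hmem 0 0).1.trans (hmem 0 0).2
  obtain ⟨y₀, hy₀, σ, hσ, hlim⟩ := isCompact_Icc.tendsto_subseq (fun n => hmem n 0)
  obtain ⟨flow, hflow, -⟩ := exists_flow_clampedField hab hT.le hf hL
  obtain ⟨hy0, hy⟩ := hflow y₀ hy₀
  have hconv := hy.tendsto_of_tendsto_field (x := x ∘ σ)
    (fun t => lipschitzWith_clampedField (hL t)) (fun n => (hx (σ n)).2.mono (subset_univ _))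
    (fun n t _ => (clampedField_of_mem (hmem (σ n) t) t).symm ▸ hF (σ n) t)
    (hε.comp hσ.tendsto_atTop) (hy0.symm ▸ hlim)
  have hymem : ∀ t ∈ Icc 0 T, flow y₀ t ∈ Icc a b := fun t ht =>
    isClosed_Icc.mem_of_tendsto (hconv t ht) (Eventually.of_forall fun n => hmem (σ n) t)
  have hyT : flow y₀ T = flow y₀ 0 := tendsto_nhds_unique (hconv T ⟨hT.le, le_rfl⟩)
    ((hconv 0 ⟨le_rfl, hT.le⟩).congr fun n => (hx (σ n)).1.eq.symm)
  obtain ⟨φ, hφ, -⟩ := exists_isPeriodicSolution_of_eq hT hf hper (hy.of_clampedField hymem) hyT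
  exact ⟨φ, hφ⟩

end PeriodicExistence

section Riccati

variable {γ : ℝ → ℝ} {T : ℝ}

theorem continuous_riccati (hγ : Continuous γ) : Continuous (uncurry (riccati γ)) :=
  (continuous_snd.pow 2).add (hγ.comp continuous_fst)

theorem periodic_riccati (hper : Periodic γ T) : Periodic (riccati γ) T := fun t =>
  funext fun x => congrArg (x ^ 2 + ·) (hper t)

theorem lipschitzOnWith_riccati (γ : ℝ → ℝ) (K : ℝ≥0) (t : ℝ) :
    LipschitzOnWith (2 * K) (riccati γ t) (Icc (-K) K) :=
  .of_dist_le_mul fun x hx y hy => by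
    have hxy : |x + y| ≤ 2 * K := abs_le.2 ⟨by linarith [hx.1, hy.1], by linarith [hx.2, hy.2]⟩
    calc dist (riccati γ t x) (riccati γ t y) = |x + y| * |x - y| := by
          rw [Real.dist_eq, ← abs_mul, riccati, riccati]
          ring_nf
      _ ≤ 2 * K * |x - y| := by gcongr

theorem IsPeriodicSolution.mem_C1T {φ : ℝ → ℝ} (hγ : Continuous γ)
    (hφ : IsPeriodicSolution (riccati γ) T φ) : φ ∈ C1T T := by
  have hderiv : deriv φ = fun t => riccati γ t (φ t) :=
    funext fun t => (hφ.2.hasDerivAt t).deriv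
  refine ⟨contDiff_one_iff_deriv.2 ⟨fun t => (hφ.2.hasDerivAt t).differentiableAt, ?_⟩, hφ.1⟩
  rw [hderiv]
  exact (continuous_riccati hγ).comp (continuous_id.prodMk hφ.2.continuous)

theorem IsPeriodicSolution.exists_nonpos {φ : ℝ → ℝ} (hT : 0 < T)
    (hφ : IsPeriodicSolution (riccati γ) T φ) : ∃ t, γ t ≤ 0 := by
  obtain ⟨t, -, ht⟩ := exists_hasDerivAt_eq_zero hT hφ.2.continuous.continuousOn hφ.1.eq.symm
    fun t _ => hφ.2.hasDerivAt t
  exact ⟨t, by linarith [sq_nonneg (φ t), show φ t ^ 2 + γ t = 0 from ht]⟩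

theorem IsPeriodicSolution.abs_le {φ : ℝ → ℝ} {K : ℝ} (hT : T ≠ 0) (hK : 0 ≤ K)
    (hγ : ∀ t, -K ^ 2 ≤ γ t) (hφ : IsPeriodicSolution (riccati γ) T φ) (t : ℝ) : |φ t| ≤ K := by
  have hsq : Continuous fun t => φ t ^ 2 := hφ.2.continuous.pow 2
  have hsqper : Periodic (fun t => φ t ^ 2) T := hφ.1.comp (· ^ 2)
  obtain ⟨_, ⟨s, rfl⟩, hs⟩ :=
    (hsqper.compact_of_continuous hT hsq).exists_isGreatest (range_nonempty _)
  have hmax : ∀ r, φ r ^ 2 ≤ φ s ^ 2 := fun r => hs (mem_range_self r)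
  have hcrit : 2 * φ s * (φ s ^ 2 + γ s) = 0 := by
    simpa [riccati] using IsLocalMax.hasDerivAt_eq_zero (f := fun t => φ t ^ 2)
      (Eventually.of_forall hmax) ((hφ.2.hasDerivAt s).pow 2)
  have hsK : φ s ^ 2 ≤ K ^ 2 := by
    rcases mul_eq_zero.1 hcrit with h | h
    · nlinarith [sq_nonneg K]
    · linarith [hγ s]
  exact abs_le_of_sq_le_sq ((hmax t).trans hsK) hK

theorem exists_isPeriodicSolution_riccati_of_supersolution (hT : 0 < T) (hγ : Continuous γ)
    (hper : Periodic γ T) {β β' : ℝ → ℝ} (hβ : ∀ t, HasDerivAt β (β' t) t) (hβT : β T ≤ β 0)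
    (hlt : ∀ t ∈ Icc 0 T, β t ^ 2 + γ t < β' t) : ∃ φ, IsPeriodicSolution (riccati γ) T φ := by
  obtain ⟨C, hC⟩ := isCompact_Icc.exists_bound_of_continuousOn (s := Icc 0 T) hγ.continuousOn
  obtain ⟨M, hM⟩ := isCompact_Icc.exists_bound_of_continuousOn (s := Icc 0 T)
    fun t _ => (hβ t).continuousAt.continuousWithinAt
  have h0 : (0 : ℝ) ∈ Icc 0 T := ⟨le_rfl, hT.le⟩
  have hC0 : 0 ≤ C := (norm_nonneg _).trans (hC 0 h0)
  have hM0 : 0 ≤ M := (norm_nonneg _).trans (hM 0 h0)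
  obtain ⟨K, hK⟩ : ∃ K : ℝ≥0, (K : ℝ) = M + C + 1 := CanLift.prf _ (by positivity)
  have hβK : ∀ t ∈ Icc 0 T, β t ∈ Icc (-K : ℝ) K := fun t ht =>
    abs_le.1 ((hM t ht).trans (by linarith))
  refine exists_isPeriodicSolution_of_subsolution_of_supersolution hT (continuous_riccati hγ)
    (periodic_riccati hper) (lipschitzOnWith_riccati γ K) (α := fun _ => -K) (α' := fun _ => 0)
    (fun t => hasDerivAt_const _ _) hβ (fun _ _ => ⟨le_rfl, by linarith⟩) hβK
    (fun t ht => ?_) hlt le_rfl hβT (hβK 0 h0).1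
  have hγt : -C ≤ γ t := neg_le_of_abs_le (hC t ht)
  simp only [riccati, hK]
  nlinarith

theorem weight_pos (p : ℝ → ℝ) (t : ℝ) : 0 < weight p t := Real.exp_pos _

theorem weight_zero (p : ℝ → ℝ) : weight p 0 = 1 := by simp [weight]

theorem hasDerivAt_weight {p : ℝ → ℝ} (hp : Continuous p) (t : ℝ) :
    HasDerivAt (weight p) (-2 * p t * weight p t) t :=
  ((hp.integral_hasStrictDerivAt 0 t).hasDerivAt.const_mul (-2)).exp.congr_deriv (by
    rw [weight]
    ring)

theorem continuous_weight {p : ℝ → ℝ} (hp : Continuous p) : Continuous (weight p) :=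
  continuous_iff_continuousAt.2 fun t => (hasDerivAt_weight hp t).continuousAt

theorem weight_eq_one_iff {p : ℝ → ℝ} : weight p T = 1 ↔ mean T p = 0 := by
  rcases eq_or_ne T 0 with rfl | hT
  · simp [weight, mean]
  · simp [weight, mean, hT]

theorem exists_linear_eq_of_mean_ne_zero {p h : ℝ → ℝ} (hp : Continuous p) (hh : Continuous h)
    (hm : mean T p ≠ 0) :
    ∃ z : ℝ → ℝ, (∀ t, HasDerivAt z (2 * p t * z t + h t) t) ∧ z T = z 0 := by
  have hW : ∀ t, weight p t ≠ 0 := fun t => (weight_pos p t).ne'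
  have hW1 : weight p T - 1 ≠ 0 := sub_ne_zero.2 (mt weight_eq_one_iff.1 hm)
  let J : ℝ → ℝ := fun t => ∫ s in (0 : ℝ)..t, weight p s * h s
  have hJ : ∀ t, HasDerivAt J (weight p t * h t) t := fun t =>
    (((continuous_weight hp).mul hh).integral_hasStrictDerivAt 0 t).hasDerivAt
  refine ⟨fun t => (J T / (weight p T - 1) + J t) / weight p t, fun t => ?_, ?_⟩
  · refine (((hJ t).const_add _).div (hasDerivAt_weight hp t) (hW t)).congr_deriv ?_
    field [hW t]
  · simp only [show J 0 = 0 from intervalIntegral.integral_same, weight_zero, add_zero, div_one]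
    field [hW T]

end Riccati

section Principal

variable {g : ℝ → ℝ} {T : ℝ}

theorem exists_gt_of_mean_ne_zero {c : ℝ} {ψ : ℝ → ℝ} (hT : 0 < T) (hg : Continuous g)
    (hper : Periodic g T) (hψ : IsPeriodicSolution (riccati fun t => g t + c) T ψ)
    (hm : mean T ψ ≠ 0) :
    ∃ c' > c, ∃ φ, IsPeriodicSolution (riccati fun t => g t + c') T φ := by
  obtain ⟨z, hz, hzT⟩ := exists_linear_eq_of_mean_ne_zero hψ.2.continuous
    (continuous_const (y := (1 : ℝ))) hm
  obtain ⟨M, hM⟩ := isCompact_Icc.exists_bound_of_continuousOn (s := Icc 0 T)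
    fun t _ => (hz t).continuousAt.continuousWithinAt
  -- `z` solves the linearization at `ψ` with forcing `1`, so `ψ + s * z` misses the equation
  -- for the constant `c + s / 2` by `s / 2 - s ^ 2 * z ^ 2`, which is positive for small `s`.
  set s : ℝ := 1 / (2 * (M ^ 2 + 1))
  have hs : 0 < s := by positivity
  have hsM : s * (M ^ 2 + 1) = 1 / 2 := by
    simp only [s]
    field
  refine ⟨c + s / 2, by linarith, exists_isPeriodicSolution_riccati_of_supersolution hT
    (hg.add continuous_const) (hper.comp (· + (c + s / 2)))
    (fun t => (hψ.2.hasDerivAt t).add ((hz t).const_mul s)) ?_ fun t ht => ?_⟩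
  · simp [hψ.1.eq, hzT]
  · have hzM : z t ^ 2 ≤ M ^ 2 := sq_le_sq' (neg_le_of_abs_le (hM t ht)) (le_of_abs_le (hM t ht))
    have hsz : s * z t ^ 2 < 1 / 2 := by nlinarith
    simp only [riccati, Pi.add_apply]
    nlinarith

theorem isClosed_setOf_exists_isPeriodicSolution (hT : 0 < T) (hg : Continuous g)
    (hper : Periodic g T) :
    IsClosed {c | ∃ φ, IsPeriodicSolution (riccati fun t => g t + c) T φ} := by
  refine isClosed_of_closure_subset fun c hc => ?_
  obtain ⟨u, hu, huc⟩ := mem_closure_iff_seq_limit.1 hc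
  choose x hx using hu
  obtain ⟨C, hC⟩ := (hper.isBounded_of_continuous hT.ne' hg).exists_norm_le
  obtain ⟨D, hD⟩ := (Metric.isBounded_range_of_tendsto u huc).exists_norm_le
  obtain ⟨K, hK⟩ : ∃ K : ℝ≥0, C + D ≤ (K : ℝ) ^ 2 := by
    obtain ⟨n, hn⟩ := exists_nat_ge (C + D)
    exact ⟨n + 1, hn.trans (by push_cast; nlinarith)⟩
  have hgC : ∀ t, -C ≤ g t := fun t => neg_le_of_abs_le (hC _ (mem_range_self t))
  have huD : ∀ n, -D ≤ u n := fun n => neg_le_of_abs_le (hD _ (mem_range_self n))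
  have hmem : ∀ n t, x n t ∈ Icc (-K : ℝ) K := fun n t =>
    abs_le.1 ((hx n).abs_le hT.ne' K.coe_nonneg (fun r => by linarith [hgC r, huD n]) t)
  exact exists_isPeriodicSolution_of_tendsto hT (continuous_riccati (hg.add continuous_const))
    (periodic_riccati (hper.comp (· + c))) (lipschitzOnWith_riccati _ K) hx hmem
    (ε := fun n => dist (u n) c) (fun n t => by simp [riccati])
    (tendsto_iff_dist_tendsto_zero.1 huc)

theorem exists_isPeriodicSolution_mean_eq_zero (hT : 0 < T) (hg : Continuous g)
    (hper : Periodic g T) :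
    ∃ c φ, IsPeriodicSolution (riccati fun t => g t + c) T φ ∧ mean T φ = 0 := by
  obtain ⟨C, hC⟩ := (hper.isBounded_of_continuous hT.ne' hg).exists_norm_le
  have hgC : ∀ t, |g t| ≤ C := fun t => hC _ (mem_range_self t)
  let S : Set ℝ := {c | ∃ φ, IsPeriodicSolution (riccati fun t => g t + c) T φ}
  have hne : S.Nonempty := by
    refine ⟨-C - 1, exists_isPeriodicSolution_riccati_of_supersolution hT
      (hg.add continuous_const) (hper.comp (· + (-C - 1))) (fun t => hasDerivAt_const t 0) le_rfl
      fun t _ => ?_⟩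
    linarith [le_of_abs_le (hgC t)]
  have hbdd : BddAbove S := by
    refine ⟨C, fun c ⟨φ, hφ⟩ => ?_⟩
    obtain ⟨t, ht⟩ := hφ.exists_nonpos hT
    linarith [neg_le_of_abs_le (hgC t)]
  obtain ⟨φ, hφ⟩ := (isClosed_setOf_exists_isPeriodicSolution hT hg hper).csSup_mem hne hbdd
  refine ⟨sSup S, φ, hφ, by_contra fun hm => ?_⟩
  obtain ⟨c', hc', hc'S⟩ := exists_gt_of_mean_ne_zero hT hg hper hφ hm
  exact (le_csSup hbdd hc'S).not_gt hc'

end Principal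

section Duality

variable {γ : ℝ → ℝ} {T c : ℝ}

theorem centered_add_mean (T : ℝ) (γ : ℝ → ℝ) : (fun t => centered T γ t + mean T γ) = γ :=
  funext fun _ => sub_add_cancel _ _

theorem continuous_centered (hγ : Continuous γ) : Continuous (centered T γ) :=
  hγ.sub continuous_const

theorem integral_weight_pos {q : ℝ → ℝ} (hT : 0 < T) (hq : Continuous q) :
    0 < ∫ t in (0 : ℝ)..T, weight q t :=
  intervalIntegral.intervalIntegral_pos_of_pos
    ((continuous_weight hq).intervalIntegrable _ _) (weight_pos q) hT

theorem integral_weight_mul_deriv_sub {p q : ℝ → ℝ} (hp : p ∈ C1T T) (hq : Continuous q)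
    (hm : mean T q = 0) : ∫ t in (0 : ℝ)..T, weight q t * (deriv p t - 2 * q t * p t) = 0 := by
  have hp' := hp.1.continuous_deriv le_rfl
  have hpc := hp.1.continuous
  have hw := continuous_weight hq
  have hprod : ∀ t, HasDerivAt (fun t => weight q t * p t)
      (weight q t * (deriv p t - 2 * q t * p t)) t := fun t =>
    ((hasDerivAt_weight hq t).mul ((hp.1.differentiable one_ne_zero) t).hasDerivAt).congr_deriv
      (by ring)
  rw [intervalIntegral.integral_eq_sub_of_hasDerivAt (fun t _ => hprod t)
    (Continuous.intervalIntegrable (by fun_prop) _ _), weight_eq_one_iff.2 hm, weight_zero,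
    hp.2.eq, sub_self]

theorem muUpper_eq_integral {p q : ℝ → ℝ} (hγ : Continuous γ) (hp : p ∈ C1T T) (hq : Continuous q)
    (hm : mean T q = 0) :
    muUpper T γ q = (∫ t in (0 : ℝ)..T, weight q t)⁻¹ * ∫ t in (0 : ℝ)..T,
      weight q t * ((q t - p t) ^ 2 - (p t ^ 2 + centered T γ t - deriv p t)) := by
  have hp' := hp.1.continuous_deriv le_rfl
  have hpc := hp.1.continuous
  have hw := continuous_weight hq
  have hc := continuous_centered (T := T) hγ
  have hsplit : ∫ t in (0 : ℝ)..T, weight q t * (q t ^ 2 - centered T γ t) =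
      (∫ t in (0 : ℝ)..T, weight q t * (q t ^ 2 - centered T γ t)) +
        ∫ t in (0 : ℝ)..T, weight q t * (deriv p t - 2 * q t * p t) := by
    rw [integral_weight_mul_deriv_sub hp hq hm, add_zero]
  rw [muUpper, hsplit, ← intervalIntegral.integral_add
    (Continuous.intervalIntegrable (by fun_prop) _ _)
    (Continuous.intervalIntegrable (by fun_prop) _ _)]
  congr! 3
  ring

theorem muLower_le {p : ℝ → ℝ} (hγ : Continuous γ) (hp : p ∈ C1T T) {t : ℝ} (ht : t ∈ Icc 0 T) :
    muLower T γ p ≤ -(p t ^ 2 + centered T γ t - deriv p t) := by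
  have hc : Continuous fun t => p t ^ 2 + centered T γ t - deriv p t :=
    ((hp.1.continuous.pow 2).add (continuous_centered hγ)).sub (hp.1.continuous_deriv le_rfl)
  exact neg_le_neg (le_csSup (isCompact_Icc.image hc).bddAbove (mem_image_of_mem _ ht))

theorem muLower_le_muUpper {p q : ℝ → ℝ} (hT : 0 < T) (hγ : Continuous γ) (hp : p ∈ C1T T)
    (hq : Continuous q) (hm : mean T q = 0) : muLower T γ p ≤ muUpper T γ q := by
  have hp' := hp.1.continuous_deriv le_rfl
  have hpc := hp.1.continuous
  have hw := continuous_weight hq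
  have hc := continuous_centered (T := T) hγ
  rw [muUpper_eq_integral hγ hp hq hm, le_inv_mul_iff₀ (integral_weight_pos hT hq),
    ← intervalIntegral.integral_mul_const]
  refine intervalIntegral.integral_mono_on hT.le
    (Continuous.intervalIntegrable (by fun_prop) _ _)
    (Continuous.intervalIntegrable (by fun_prop) _ _)
    fun t ht => mul_le_mul_of_nonneg_left ?_ (weight_pos q t).le
  linarith [muLower_le hγ hp ht, sq_nonneg (q t - p t)]

theorem IsPeriodicSolution.sq_add_centered_sub_deriv {φ : ℝ → ℝ}
    (hφ : IsPeriodicSolution (riccati fun t => centered T γ t + c) T φ) (t : ℝ) :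
    φ t ^ 2 + centered T γ t - deriv φ t = -c := by
  rw [(hφ.2.hasDerivAt t).deriv, riccati]
  ring

theorem IsPeriodicSolution.muLower_eq {φ : ℝ → ℝ} (hT : 0 ≤ T)
    (hφ : IsPeriodicSolution (riccati fun t => centered T γ t + c) T φ) : muLower T γ φ = c := by
  simp only [muLower, hφ.sq_add_centered_sub_deriv, (nonempty_Icc.2 hT).image_const,
    csSup_singleton, neg_neg]

theorem IsPeriodicSolution.muUpper_eq {φ : ℝ → ℝ} (hT : 0 < T) (hγ : Continuous γ)
    (hφ : IsPeriodicSolution (riccati fun t => centered T γ t + c) T φ) (hm : mean T φ = 0) :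
    muUpper T γ φ = c := by
  have hφC := hφ.mem_C1T ((continuous_centered hγ).add continuous_const)
  have hpos := integral_weight_pos hT hφC.1.continuous
  simp only [muUpper_eq_integral hγ hφC hφC.1.continuous hm, hφ.sq_add_centered_sub_deriv,
    sub_self, ne_eq, OfNat.ofNat_ne_zero, not_false_eq_true, zero_pow, zero_sub, neg_neg,
    intervalIntegral.integral_mul_const, inv_mul_cancel_left₀ hpos.ne']

theorem isGreatest_muLower {φ : ℝ → ℝ} (hT : 0 < T) (hγ : Continuous γ)
    (hφ : IsPeriodicSolution (riccati fun t => centered T γ t + c) T φ) (hm : mean T φ = 0) :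
    IsGreatest (muLower T γ '' C1T T) c := by
  refine ⟨⟨φ, hφ.mem_C1T ((continuous_centered hγ).add continuous_const), hφ.muLower_eq hT.le⟩,
    forall_mem_image.2 fun p hp => ?_⟩
  rw [← hφ.muUpper_eq hT hγ hm]
  exact muLower_le_muUpper hT hγ hp hφ.2.continuous hm

theorem isLeast_muUpper {φ : ℝ → ℝ} (hT : 0 < T) (hγ : Continuous γ)
    (hφ : IsPeriodicSolution (riccati fun t => centered T γ t + c) T φ) (hm : mean T φ = 0) :
    IsLeast (muUpper T γ '' C1T0 T) c := by
  have hφC := hφ.mem_C1T ((continuous_centered hγ).add continuous_const)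
  refine ⟨⟨φ, ⟨hφC, hm⟩, hφ.muUpper_eq hT hγ hm⟩, forall_mem_image.2 fun q hq => ?_⟩
  rw [← hφ.muLower_eq hT.le]
  exact muLower_le_muUpper hT hγ hφC hq.1.1.continuous hq.2

theorem IsPeriodicSolution.gammaStar_eq {φ : ℝ → ℝ} (hT : 0 < T) (hγ : Continuous γ)
    (hφ : IsPeriodicSolution (riccati fun t => centered T γ t + c) T φ) (hm : mean T φ = 0) :
    gammaStar T γ = c :=
  (isGreatest_muLower hT hγ hφ hm).csSup_eq

theorem exists_isPeriodicSolution_gammaStar (hT : 0 < T) (hγ : Continuous γ)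
    (hper : Periodic γ T) :
    ∃ φ, IsPeriodicSolution (riccati fun t => centered T γ t + gammaStar T γ) T φ ∧
      mean T φ = 0 := by
  obtain ⟨c, φ, hφ, hm⟩ := exists_isPeriodicSolution_mean_eq_zero hT
    (continuous_centered (T := T) hγ) (hper.comp (· - mean T γ))
  exact ⟨φ, by rwa [hφ.gammaStar_eq hT hγ hm], hm⟩

theorem isGreatest_gammaStar (hT : 0 < T) (hγ : Continuous γ) (hper : Periodic γ T) :
    IsGreatest (muLower T γ '' C1T T) (gammaStar T γ) :=
  let ⟨_, hφ, hm⟩ := exists_isPeriodicSolution_gammaStar hT hγ hper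
  isGreatest_muLower hT hγ hφ hm

theorem isLeast_gammaStar (hT : 0 < T) (hγ : Continuous γ) (hper : Periodic γ T) :
    IsLeast (muUpper T γ '' C1T0 T) (gammaStar T γ) :=
  let ⟨_, hφ, hm⟩ := exists_isPeriodicSolution_gammaStar hT hγ hper
  isLeast_muUpper hT hγ hφ hm

end Duality

section Discriminant

variable {γ φ : ℝ → ℝ} {T : ℝ}

theorem IsPeriodicSolution.riccati_centered (hφ : IsPeriodicSolution (riccati γ) T φ) :
    IsPeriodicSolution (riccati fun t => centered T γ t + mean T γ) T φ := by
  rwa [centered_add_mean]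

theorem IsPeriodicSolution.discriminant_nonneg (hT : 0 < T) (hγ : Continuous γ)
    (hper : Periodic γ T) (hφ : IsPeriodicSolution (riccati γ) T φ) : 0 ≤ discriminant T γ :=
  sub_nonneg.2 ((isGreatest_gammaStar hT hγ hper).2
    ⟨φ, hφ.mem_C1T hγ, hφ.riccati_centered.muLower_eq hT.le⟩)

theorem IsPeriodicSolution.discriminant_eq_zero (hT : 0 < T) (hγ : Continuous γ)
    (hφ : IsPeriodicSolution (riccati γ) T φ) (hm : mean T φ = 0) : discriminant T γ = 0 :=
  sub_eq_zero.2 (hφ.riccati_centered.gammaStar_eq hT hγ hm)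

theorem exists_isPeriodicSolution_of_discriminant_eq_zero (hT : 0 < T) (hγ : Continuous γ)
    (hper : Periodic γ T) (hΔ : discriminant T γ = 0) :
    ∃ φ, IsPeriodicSolution (riccati γ) T φ ∧ mean T φ = 0 := by
  simpa only [sub_eq_zero.1 hΔ, centered_add_mean] using
    exists_isPeriodicSolution_gammaStar hT hγ hper

theorem exists_isPeriodicSolution_of_discriminant_pos (hT : 0 < T) (hγ : Continuous γ)
    (hper : Periodic γ T) (hΔ : 0 < discriminant T γ) :
    ∃ φ, IsPeriodicSolution (riccati γ) T φ := by
  obtain ⟨β, hβ, -⟩ := exists_isPeriodicSolution_gammaStar hT hγ hper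
  refine exists_isPeriodicSolution_riccati_of_supersolution hT hγ hper hβ.2.hasDerivAt hβ.1.eq.le
    fun t _ => ?_
  rw [discriminant] at hΔ
  simp only [riccati, centered]
  linarith

end Discriminant

section ShiftedSolution

/-- The primitive of `1 / weight p` vanishing at `0`. For a solution `ψ` of the Riccati equation,
the substitution `x = ψ + 1 / y` turns the equation into the linear one `y' = -2 * ψ * y - 1`,
which is integrated by means of this primitive. -/
noncomputable def invWeightPrimitive (p : ℝ → ℝ) (t : ℝ) : ℝ := ∫ s in (0 : ℝ)..t, (weight p s)⁻¹

/-- The solution of the Riccati equation starting at `ψ 0 + v`, expressed through the solution `ψ`.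
It is meaningful as long as the denominator does not vanish; it blows up when the denominator
reaches `0`. -/
noncomputable def shiftedSolution (ψ : ℝ → ℝ) (v t : ℝ) : ℝ :=
  ψ t + v / (weight ψ t * (1 - v * invWeightPrimitive ψ t))

variable {γ ψ x : ℝ → ℝ} {T t v : ℝ}

theorem continuous_inv_weight (hψ : Continuous ψ) : Continuous fun s => (weight ψ s)⁻¹ :=
  (continuous_weight hψ).inv₀ fun s => (weight_pos ψ s).ne'

theorem hasDerivAt_invWeightPrimitive (hψ : Continuous ψ) (t : ℝ) :
    HasDerivAt (invWeightPrimitive ψ) (weight ψ t)⁻¹ t :=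
  ((continuous_inv_weight hψ).integral_hasStrictDerivAt 0 t).hasDerivAt

theorem invWeightPrimitive_zero (ψ : ℝ → ℝ) : invWeightPrimitive ψ 0 = 0 :=
  intervalIntegral.integral_same

theorem strictMono_invWeightPrimitive (hψ : Continuous ψ) : StrictMono (invWeightPrimitive ψ) :=
  strictMono_of_deriv_pos fun t => by
    rw [(hasDerivAt_invWeightPrimitive hψ t).deriv]
    exact inv_pos.2 (weight_pos ψ t)

theorem invWeightPrimitive_nonneg (hψ : Continuous ψ) (ht : 0 ≤ t) :
    0 ≤ invWeightPrimitive ψ t :=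
  (invWeightPrimitive_zero ψ).ge.trans ((strictMono_invWeightPrimitive hψ).monotone ht)

theorem invWeightPrimitive_nonpos (hψ : Continuous ψ) (ht : t ≤ 0) :
    invWeightPrimitive ψ t ≤ 0 :=
  ((strictMono_invWeightPrimitive hψ).monotone ht).trans (invWeightPrimitive_zero ψ).le

theorem invWeightPrimitive_pos (hψ : Continuous ψ) (ht : 0 < t) : 0 < invWeightPrimitive ψ t :=
  (invWeightPrimitive_zero ψ).ge.trans_lt (strictMono_invWeightPrimitive hψ ht)

theorem shiftedSolution_zero (ψ : ℝ → ℝ) (v : ℝ) : shiftedSolution ψ v 0 = ψ 0 + v := by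
  simp [shiftedSolution, weight_zero, invWeightPrimitive_zero]

theorem isSolutionOn_shiftedSolution {s : Set ℝ} (hψ : IsSolutionOn (riccati γ) ψ univ)
    (hs : ∀ t ∈ s, 1 - v * invWeightPrimitive ψ t ≠ 0) :
    IsSolutionOn (riccati γ) (shiftedSolution ψ v) s := by
  intro t ht
  have hW := (weight_pos ψ t).ne'
  have hB := hs t ht
  have hderiv := (hψ.hasDerivAt t).add ((hasDerivAt_const t v).div
    ((hasDerivAt_weight hψ.continuous t).mul
      (((hasDerivAt_invWeightPrimitive hψ.continuous t).const_mul v).const_sub 1))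
    (mul_ne_zero hW hB))
  refine (hderiv.congr_deriv ?_).hasDerivWithinAt
  simp only [riccati, shiftedSolution, Pi.mul_apply]
  field

theorem IsSolutionOn.weight_mul_sub_mul_eq (hψ : IsSolutionOn (riccati γ) ψ univ)
    (hx : IsSolutionOn (riccati γ) x (Icc 0 T)) (ht : t ∈ Icc 0 T) :
    weight ψ t * (x t - ψ t) * (1 - (x 0 - ψ 0) * invWeightPrimitive ψ t) = x 0 - ψ 0 := by
  set v := x 0 - ψ 0
  obtain ⟨K, hK⟩ := isCompact_Icc.exists_bound_of_continuousOn
    (hx.continuousOn.sub hψ.continuous.continuousOn)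
  -- The difference of the two sides vanishes at `0` and solves the linear equation
  -- `G' = (x - ψ) * G`, so it vanishes identically; this avoids dividing by a possible zero.
  let G : ℝ → ℝ := fun t => weight ψ t * (x t - ψ t) * (1 - v * invWeightPrimitive ψ t) - v
  have hG : ∀ t ∈ Icc 0 T, HasDerivWithinAt G ((x t - ψ t) * G t) (Icc 0 T) t := by
    intro t ht
    have hW := (weight_pos ψ t).ne'
    have hderiv := ((((hasDerivAt_weight hψ.continuous t).hasDerivWithinAt (s := Icc 0 T)).mul
      ((hx t ht).sub (hψ.hasDerivAt t).hasDerivWithinAt)).mul (((hasDerivAt_invWeightPrimitive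
        hψ.continuous t).const_mul v).const_sub 1).hasDerivWithinAt).sub_const v
    refine hderiv.congr_deriv ?_
    simp only [riccati, G, Pi.mul_apply, Pi.sub_apply]
    field
  have hG0 : G t = 0 := eq_zero_of_abs_deriv_le_mul_abs_self_of_eq_zero_right
    (fun t ht => (hG t ht).continuousWithinAt)
    (fun t ht => (hG t (Ico_subset_Icc_self ht)).mono_of_mem_nhdsWithin (Icc_mem_nhdsGE_of_mem ht))
    (by simp [G, weight_zero, invWeightPrimitive_zero, v])
    (fun t ht => (norm_mul _ _).le.trans
      (mul_le_mul_of_nonneg_right (hK t (Ico_subset_Icc_self ht)) (norm_nonneg _))) t ht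
  exact sub_eq_zero.1 hG0

theorem IsSolutionOn.eq_shiftedSolution (hψ : IsSolutionOn (riccati γ) ψ univ)
    (hx : IsSolutionOn (riccati γ) x (Icc 0 T)) (ht : t ∈ Icc 0 T) :
    x t = shiftedSolution ψ (x 0 - ψ 0) t := by
  have h := hψ.weight_mul_sub_mul_eq hx ht
  have hW := (weight_pos ψ t).ne'
  rcases eq_or_ne (x 0 - ψ 0) 0 with hv | hv
  · simpa [shiftedSolution, hv, hW, sub_eq_zero] using h
  · have hB : 1 - (x 0 - ψ 0) * invWeightPrimitive ψ t ≠ 0 := right_ne_zero_of_mul (h.trans_ne hv)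
    rw [shiftedSolution, ← sub_eq_iff_eq_add', eq_div_iff (mul_ne_zero hW hB)]
    linarith

theorem IsPeriodicSolution.eq_of_apply_zero_eq {φ : ℝ → ℝ} (hT : 0 < T)
    (hψ : IsPeriodicSolution (riccati γ) T ψ) (hφ : IsPeriodicSolution (riccati γ) T φ)
    (h0 : φ 0 = ψ 0) : φ = ψ := by
  have hdiff : Periodic (φ - ψ) T := hφ.1.sub hψ.1
  funext t
  obtain ⟨s, hs, hst⟩ := hdiff.exists_mem_Ico₀ hT t
  have hφs := hψ.2.eq_shiftedSolution (hφ.2.mono (subset_univ (Icc 0 T))) (Ico_subset_Icc_self hs)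
  rw [h0, sub_self, shiftedSolution, zero_div, add_zero] at hφs
  rwa [Pi.sub_apply, Pi.sub_apply, hφs, sub_self, sub_eq_zero] at hst

theorem one_sub_mul_invWeightPrimitive_pos (hψ : Continuous ψ)
    (hv : v * invWeightPrimitive ψ T < 1) (ht : t ∈ Icc 0 T) :
    0 < 1 - v * invWeightPrimitive ψ t := by
  have h0 := invWeightPrimitive_nonneg hψ ht.1
  have hT := (strictMono_invWeightPrimitive hψ).monotone ht.2
  rcases le_total v 0 with h | h <;> nlinarith

end ShiftedSolution

section Displacement

variable {γ ψ : ℝ → ℝ} {T v : ℝ}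

theorem IsPeriodicSolution.displacement_add (hT : 0 ≤ T)
    (hψ : IsPeriodicSolution (riccati γ) T ψ) (hv : v * invWeightPrimitive ψ T < 1) :
    displacement (riccati γ) T (ψ 0 + v) =
      v / (weight ψ T * (1 - v * invWeightPrimitive ψ T)) - v := by
  have hex : ∃ x : ℝ → ℝ, x 0 = ψ 0 + v ∧ IsSolutionOn (riccati γ) x (Icc 0 T) :=
    ⟨shiftedSolution ψ v, shiftedSolution_zero ψ v, isSolutionOn_shiftedSolution hψ.2 fun t ht =>
      (one_sub_mul_invWeightPrimitive_pos hψ.2.continuous hv ht).ne'⟩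
  have hxT := hψ.2.eq_shiftedSolution hex.choose_spec.2 ⟨hT, le_rfl⟩
  rw [hex.choose_spec.1, add_sub_cancel_left] at hxT
  rw [displacement, poincareMap, dif_pos hex, hxT, shiftedSolution, hψ.1.eq]
  ring

theorem IsPeriodicSolution.displacement_eventuallyEq (hT : 0 ≤ T)
    (hψ : IsPeriodicSolution (riccati γ) T ψ) :
    displacement (riccati γ) T =ᶠ[𝓝 (ψ 0)] fun x =>
      (x - ψ 0) / (weight ψ T * (1 - (x - ψ 0) * invWeightPrimitive ψ T)) - (x - ψ 0) := by
  have hc : Continuous fun x => (x - ψ 0) * invWeightPrimitive ψ T := by fun_prop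
  filter_upwards [hc.continuousAt.eventually_lt continuousAt_const (by simp :
    (ψ 0 - ψ 0) * invWeightPrimitive ψ T < 1)] with x hx
  rw [← hψ.displacement_add hT hx, add_sub_cancel]

theorem hasDerivAt_sub_div_sub {a W B x : ℝ} (hW : W ≠ 0) (hx : 1 - (x - a) * B ≠ 0) :
    HasDerivAt (fun x => (x - a) / (W * (1 - (x - a) * B)) - (x - a))
      ((W * (1 - (x - a) * B) ^ 2)⁻¹ - 1) x := by
  have h := (hasDerivAt_id' x).sub_const a
  refine ((h.div (((h.mul_const B).const_sub 1).const_mul W)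
    (mul_ne_zero hW hx)).sub h).congr_deriv ?_
  field

theorem IsPeriodicSolution.contDiffAt_displacement {n : WithTop ℕ∞} (hT : 0 ≤ T)
    (hψ : IsPeriodicSolution (riccati γ) T ψ) :
    ContDiffAt ℝ n (displacement (riccati γ) T) (ψ 0) := by
  refine ContDiffAt.congr_of_eventuallyEq ?_ (hψ.displacement_eventuallyEq hT)
  have hW := (weight_pos ψ T).ne'
  exact (ContDiffAt.div (by fun_prop) (by fun_prop) (by simpa)).sub (by fun_prop)

theorem IsPeriodicSolution.displacement_apply_zero (hT : 0 ≤ T)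
    (hψ : IsPeriodicSolution (riccati γ) T ψ) : displacement (riccati γ) T (ψ 0) = 0 := by
  simpa using hψ.displacement_add hT (v := 0) (by simp)

theorem IsPeriodicSolution.deriv_displacement_eventuallyEq (hT : 0 ≤ T)
    (hψ : IsPeriodicSolution (riccati γ) T ψ) :
    deriv (displacement (riccati γ) T) =ᶠ[𝓝 (ψ 0)] fun x =>
      (weight ψ T * (1 - (x - ψ 0) * invWeightPrimitive ψ T) ^ 2)⁻¹ - 1 := by
  have hc : Continuous fun x => 1 - (x - ψ 0) * invWeightPrimitive ψ T := by fun_prop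
  filter_upwards [(hψ.displacement_eventuallyEq hT).eventuallyEq_nhds,
    hc.continuousAt.eventually_ne (by simp : 1 - (ψ 0 - ψ 0) * invWeightPrimitive ψ T ≠ 0)]
    with x hdisp hx
  rw [hdisp.deriv_eq, (hasDerivAt_sub_div_sub (weight_pos ψ T).ne' hx).deriv]

theorem IsPeriodicSolution.deriv_displacement (hT : 0 ≤ T)
    (hψ : IsPeriodicSolution (riccati γ) T ψ) :
    deriv (displacement (riccati γ) T) (ψ 0) = (weight ψ T)⁻¹ - 1 := by
  simp [(hψ.deriv_displacement_eventuallyEq hT).eq_of_nhds]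

theorem IsPeriodicSolution.iteratedDeriv_two_displacement (hT : 0 ≤ T)
    (hψ : IsPeriodicSolution (riccati γ) T ψ) :
    iteratedDeriv 2 (displacement (riccati γ) T) (ψ 0) =
      2 * invWeightPrimitive ψ T / weight ψ T := by
  have hW := (weight_pos ψ T).ne'
  have hderiv := (((((((hasDerivAt_id' (ψ 0)).sub_const (ψ 0)).mul_const
    (invWeightPrimitive ψ T)).const_sub 1).pow 2).const_mul (weight ψ T)).inv
      (by simpa)).sub_const 1
  rw [iteratedDeriv_succ, iteratedDeriv_one, (hψ.deriv_displacement_eventuallyEq hT).deriv_eq]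
  refine (hderiv.congr_deriv ?_).deriv
  simp only [Nat.cast_ofNat, sub_self, zero_mul, sub_zero, Nat.add_one_sub_one, one_pow, mul_one,
    one_mul, mul_neg, neg_neg, Pi.pow_apply]
  field

theorem IsPeriodicSolution.isHyperbolic (hT : 0 ≤ T) (hψ : IsPeriodicSolution (riccati γ) T ψ)
    (hm : mean T ψ ≠ 0) : IsHyperbolic (riccati γ) T ψ := by
  refine ⟨hψ.contDiffAt_displacement hT, fun k hk => ?_, ?_⟩
  · obtain rfl := Nat.lt_one_iff.1 hk
    exact hψ.displacement_apply_zero hT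
  · rw [iteratedDeriv_one, hψ.deriv_displacement hT, sub_ne_zero, inv_ne_one]
    exact mt weight_eq_one_iff.1 hm

theorem IsPeriodicSolution.isDouble (hT : 0 < T) (hψ : IsPeriodicSolution (riccati γ) T ψ)
    (hm : mean T ψ = 0) : IsDouble (riccati γ) T ψ := by
  refine ⟨hψ.contDiffAt_displacement hT.le, fun k hk => ?_, ?_⟩
  · interval_cases k
    · exact hψ.displacement_apply_zero hT.le
    · rw [iteratedDeriv_one, hψ.deriv_displacement hT.le, weight_eq_one_iff.2 hm, inv_one, sub_self]
  · rw [hψ.iteratedDeriv_two_displacement hT.le]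
    exact div_ne_zero (mul_ne_zero two_ne_zero
      (invWeightPrimitive_pos hψ.2.continuous hT).ne') (weight_pos ψ T).ne'

end Displacement

section Semistability

variable {γ ψ : ℝ → ℝ} {T v x₀ : ℝ}

theorem periodic_inv_weight (hψ : Continuous ψ) (hper : Periodic ψ T) (hm : mean T ψ = 0) :
    Periodic (fun t => (weight ψ t)⁻¹) T := by
  rcases eq_or_ne T 0 with rfl | hT
  · intro t
    simp
  · have h0 : ∫ s in (0 : ℝ)..T, ψ s = 0 := by simpa [mean, hT] using hm
    exact (periodic_intervalIntegral hψ hper h0).comp fun r => (Real.exp (-2 * r))⁻¹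

theorem tendsto_invWeightPrimitive_atTop (hT : 0 < T) (hψ : Continuous ψ) (hper : Periodic ψ T)
    (hm : mean T ψ = 0) : Tendsto (invWeightPrimitive ψ) atTop atTop :=
  (periodic_inv_weight hψ hper hm).tendsto_atTop_intervalIntegral_of_pos'
    ((continuous_inv_weight hψ).intervalIntegrable _ _) (fun s => inv_pos.2 (weight_pos ψ s)) hT

theorem tendsto_invWeightPrimitive_atBot (hT : 0 < T) (hψ : Continuous ψ) (hper : Periodic ψ T)
    (hm : mean T ψ = 0) : Tendsto (invWeightPrimitive ψ) atBot atBot :=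
  (periodic_inv_weight hψ hper hm).tendsto_atBot_intervalIntegral_of_pos'
    ((continuous_inv_weight hψ).intervalIntegrable _ _) (fun s => inv_pos.2 (weight_pos ψ s)) hT

theorem tendsto_shiftedSolution_sub {l : Filter ℝ} (hT : T ≠ 0) (hψ : Continuous ψ)
    (hper : Periodic ψ T) (hm : mean T ψ = 0)
    (hl : Tendsto (fun t => v * invWeightPrimitive ψ t) l atBot) :
    Tendsto (fun t => shiftedSolution ψ v t - ψ t) l (𝓝 0) := by
  obtain ⟨C, hC⟩ := ((periodic_inv_weight hψ hper hm).isBounded_of_continuous hT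
    (continuous_inv_weight hψ)).exists_norm_le
  have hdiv : Tendsto (fun t => v / (1 - v * invWeightPrimitive ψ t)) l (𝓝 0) :=
    (tendsto_atTop_add_const_left l 1 (tendsto_neg_atBot_atTop.comp hl)).const_div_atTop v
  refine (hdiv.zero_mul_isBoundedUnder_le (g := fun s => (weight ψ s)⁻¹)
    (isBoundedUnder_of ⟨C, fun t => hC _ (mem_range_self t)⟩)).congr fun t => ?_
  rw [shiftedSolution, add_sub_cancel_left, div_mul_eq_div_div_swap,
    div_eq_mul_inv _ (weight ψ t)]

theorem IsPeriodicSolution.forwardAsymptotic (hT : 0 < T)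
    (hψ : IsPeriodicSolution (riccati γ) T ψ) (hm : mean T ψ = 0) (hx₀ : x₀ < ψ 0) :
    ForwardAsymptotic (riccati γ) ψ x₀ := by
  have hψc := hψ.2.continuous
  refine ⟨shiftedSolution ψ (x₀ - ψ 0), by rw [shiftedSolution_zero, add_sub_cancel],
    isSolutionOn_shiftedSolution hψ.2 fun t ht => ?_,
    tendsto_shiftedSolution_sub hT.ne' hψc hψ.1 hm
      ((tendsto_invWeightPrimitive_atTop hT hψc hψ.1 hm).const_mul_atTop_of_neg (sub_neg.2 hx₀))⟩
  have := mul_nonpos_of_nonpos_of_nonneg (sub_neg.2 hx₀).le (invWeightPrimitive_nonneg hψc ht)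
  linarith

theorem IsPeriodicSolution.backwardAsymptotic (hT : 0 < T)
    (hψ : IsPeriodicSolution (riccati γ) T ψ) (hm : mean T ψ = 0) (hx₀ : ψ 0 < x₀) :
    BackwardAsymptotic (riccati γ) ψ x₀ := by
  have hψc := hψ.2.continuous
  refine ⟨shiftedSolution ψ (x₀ - ψ 0), by rw [shiftedSolution_zero, add_sub_cancel],
    isSolutionOn_shiftedSolution hψ.2 fun t ht => ?_,
    tendsto_shiftedSolution_sub hT.ne' hψc hψ.1 hm
      ((tendsto_invWeightPrimitive_atBot hT hψc hψ.1 hm).const_mul_atBot (sub_pos.2 hx₀))⟩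
  have := mul_nonpos_of_nonneg_of_nonpos (sub_pos.2 hx₀).le (invWeightPrimitive_nonpos hψc ht)
  linarith

theorem IsPeriodicSolution.isSemistable (hT : 0 < T) (hψ : IsPeriodicSolution (riccati γ) T ψ)
    (hm : mean T ψ = 0) : IsSemistable (riccati γ) ψ :=
  ⟨1, one_pos, Or.inl ⟨fun _ hx => hψ.forwardAsymptotic hT hm hx.2,
    fun _ hx => hψ.backwardAsymptotic hT hm hx.1⟩⟩

end Semistability

section LimitCycles

variable {γ ψ : ℝ → ℝ} {T : ℝ}

theorem IsPeriodicSolution.exists_apply_zero_eq_add (hT : 0 < T) (hγ : Continuous γ)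
    (hper : Periodic γ T) (hψ : IsPeriodicSolution (riccati γ) T ψ) :
    ∃ χ, IsPeriodicSolution (riccati γ) T χ ∧
      χ 0 = ψ 0 + (1 - (weight ψ T)⁻¹) / invWeightPrimitive ψ T := by
  have hψc := hψ.2.continuous
  have hW := weight_pos ψ T
  set v := (1 - (weight ψ T)⁻¹) / invWeightPrimitive ψ T
  have hv : v * invWeightPrimitive ψ T = 1 - (weight ψ T)⁻¹ :=
    div_mul_cancel₀ _ (invWeightPrimitive_pos hψc hT).ne'
  have hlt : v * invWeightPrimitive ψ T < 1 := hv.trans_lt (sub_lt_self _ (inv_pos.2 hW))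
  rw [← shiftedSolution_zero ψ v]
  refine exists_isPeriodicSolution_of_eq hT (continuous_riccati hγ) (periodic_riccati hper)
    (isSolutionOn_shiftedSolution hψ.2 fun t ht =>
      (one_sub_mul_invWeightPrimitive_pos hψc hlt ht).ne') ?_
  rw [shiftedSolution_zero, shiftedSolution, hψ.1.eq, hv, sub_sub_cancel, mul_inv_cancel₀ hW.ne',
    div_one]

theorem IsPeriodicSolution.apply_zero_eq_or {φ : ℝ → ℝ} (hT : 0 < T)
    (hψ : IsPeriodicSolution (riccati γ) T ψ) (hφ : IsPeriodicSolution (riccati γ) T φ) :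
    φ 0 = ψ 0 ∨ φ 0 = ψ 0 + (1 - (weight ψ T)⁻¹) / invWeightPrimitive ψ T := by
  have hB := (invWeightPrimitive_pos hψ.2.continuous hT).ne'
  have h := hψ.2.weight_mul_sub_mul_eq (hφ.2.mono (subset_univ (Icc 0 T))) ⟨hT.le, le_rfl⟩
  rw [hψ.1.eq, hφ.1.eq] at h
  refine or_iff_not_imp_left.2 fun hne => ?_
  have hcancel : weight ψ T * (1 - (φ 0 - ψ 0) * invWeightPrimitive ψ T) = 1 :=
    mul_right_cancel₀ (sub_ne_zero.2 hne) (by linarith)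
  rw [← sub_eq_iff_eq_add', eq_div_iff hB, ← eq_inv_of_mul_eq_one_right hcancel, sub_sub_cancel]

theorem IsPeriodicSolution.exists_setOf_isPeriodicSolution_eq (hT : 0 < T) (hγ : Continuous γ)
    (hper : Periodic γ T) (hψ : IsPeriodicSolution (riccati γ) T ψ) :
    ∃ χ, {φ | IsPeriodicSolution (riccati γ) T φ} = {ψ, χ} ∧ (ψ = χ ↔ mean T ψ = 0) := by
  obtain ⟨χ, hχ, hχ0⟩ := hψ.exists_apply_zero_eq_add hT hγ hper
  have hB := (invWeightPrimitive_pos hψ.2.continuous hT).ne'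
  refine ⟨χ, Set.ext fun φ => ⟨fun hφ => ?_, ?_⟩, ?_⟩
  · exact (hψ.apply_zero_eq_or hT hφ).imp (hψ.eq_of_apply_zero_eq hT hφ)
      fun h => hχ.eq_of_apply_zero_eq hT hφ (h.trans hχ0.symm)
  · rintro (rfl | rfl)
    exacts [hψ, hχ]
  · calc ψ = χ ↔ ψ 0 = χ 0 := ⟨fun h => congrFun h 0, hχ.eq_of_apply_zero_eq hT hψ⟩
      _ ↔ weight ψ T = 1 := by
        rw [hχ0, left_eq_add, div_eq_zero_iff, or_iff_left hB, sub_eq_zero, eq_comm, inv_eq_one]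
      _ ↔ mean T ψ = 0 := weight_eq_one_iff

theorem setOf_isLimitCycle_eq_of_finite (hT : 0 < T)
    (hfin : {φ | IsPeriodicSolution (riccati γ) T φ}.Finite) :
    {φ | IsLimitCycle (riccati γ) T φ} = {φ | IsPeriodicSolution (riccati γ) T φ} := by
  refine Set.ext fun φ => ⟨fun hφ => hφ.1, fun hφ => ⟨hφ, ?_⟩⟩
  let others : Set ℝ := (fun ψ => ψ 0) '' ({ψ | IsPeriodicSolution (riccati γ) T ψ} \ {φ})
  have hφ0 : φ 0 ∉ others := by
    rintro ⟨ψ, ⟨hψ, hne⟩, h0⟩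
    exact hne (IsPeriodicSolution.eq_of_apply_zero_eq hT hφ hψ h0)
  obtain ⟨ε, hε, hball⟩ := Metric.mem_nhds_iff.1
    (((hfin.subset sdiff_subset).image _).isClosed.isOpen_compl.mem_nhds hφ0)
  exact ⟨ε, hε, fun ψ hψ hd => by_contra fun hne => hball hd ⟨ψ, ⟨hψ, hne⟩, rfl⟩⟩

theorem IsPeriodicSolution.exists_setOf_isLimitCycle_eq (hT : 0 < T) (hγ : Continuous γ)
    (hper : Periodic γ T) (hψ : IsPeriodicSolution (riccati γ) T ψ) :
    ∃ χ, {φ | IsLimitCycle (riccati γ) T φ} = {ψ, χ} ∧ (ψ = χ ↔ mean T ψ = 0) := by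
  obtain ⟨χ, hset, hχ⟩ := hψ.exists_setOf_isPeriodicSolution_eq hT hγ hper
  exact ⟨χ, (setOf_isLimitCycle_eq_of_finite hT (hset ▸ toFinite _)).trans hset, hχ⟩

theorem exists_hyperbolic_pair_of_discriminant_pos (hT : 0 < T) (hγ : Continuous γ)
    (hper : Periodic γ T) (hΔ : 0 < discriminant T γ) :
    ∃ φ₁ φ₂ : ℝ → ℝ, φ₁ ≠ φ₂ ∧ {φ | IsLimitCycle (riccati γ) T φ} = {φ₁, φ₂} ∧
      IsHyperbolic (riccati γ) T φ₁ ∧ IsHyperbolic (riccati γ) T φ₂ := by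
  obtain ⟨ψ, hψ⟩ := exists_isPeriodicSolution_of_discriminant_pos hT hγ hper hΔ
  have hmean : ∀ {φ}, IsPeriodicSolution (riccati γ) T φ → mean T φ ≠ 0 := fun hφ hm =>
    hΔ.ne' (hφ.discriminant_eq_zero hT hγ hm)
  obtain ⟨χ, hset, hχψ⟩ := hψ.exists_setOf_isLimitCycle_eq hT hγ hper
  have hχ : IsLimitCycle (riccati γ) T χ := hset.ge (mem_insert_of_mem _ rfl)
  exact ⟨ψ, χ, hχψ.not.2 (hmean hψ), hset, hψ.isHyperbolic hT.le (hmean hψ),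
    hχ.1.isHyperbolic hT.le (hmean hχ.1)⟩

theorem exists_semistable_double_of_discriminant_eq_zero (hT : 0 < T) (hγ : Continuous γ)
    (hper : Periodic γ T) (hΔ : discriminant T γ = 0) :
    ∃ φ : ℝ → ℝ, {ψ | IsLimitCycle (riccati γ) T ψ} = {φ} ∧
      IsSemistable (riccati γ) φ ∧ IsDouble (riccati γ) T φ := by
  obtain ⟨φ, hφ, hm⟩ := exists_isPeriodicSolution_of_discriminant_eq_zero hT hγ hper hΔ
  obtain ⟨χ, hset, hχ⟩ := hφ.exists_setOf_isLimitCycle_eq hT hγ hper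
  rw [← hχ.2 hm, pair_eq_singleton] at hset
  exact ⟨φ, hset, hφ.isSemistable hT hm, hφ.isDouble hT hm⟩

end LimitCycles

end RiccatiEq

open RiccatiEq in
theorem mainTheorem2_general (T : ℝ) (hT : 0 < T) (γ : ℝ → ℝ) (hγ : Continuous γ)
    (hper : Function.Periodic γ T) :
    (IsGreatest (muLower T γ '' C1T T) (gammaStar T γ) ∧
      IsLeast (muUpper T γ '' C1T0 T) (gammaStar T γ)) ∧
    (0 < discriminant T γ →
      ∃ φ₁ φ₂ : ℝ → ℝ, φ₁ ≠ φ₂ ∧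
        {φ | IsLimitCycle (riccati γ) T φ} = {φ₁, φ₂} ∧
        IsHyperbolic (riccati γ) T φ₁ ∧ IsHyperbolic (riccati γ) T φ₂) ∧
    (discriminant T γ = 0 →
      ∃ φ : ℝ → ℝ, {ψ | IsLimitCycle (riccati γ) T ψ} = {φ} ∧
        IsSemistable (riccati γ) φ ∧ IsDouble (riccati γ) T φ) ∧
    (discriminant T γ < 0 → ¬ ∃ φ : ℝ → ℝ, IsLimitCycle (riccati γ) T φ) ∧
    (∀ p ∈ C1T T, ∀ q ∈ C1T0 T,
      muLower T γ p - mean T γ ≤ discriminant T γ ∧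
        discriminant T γ ≤ muUpper T γ q - mean T γ) := by
  have hmax := isGreatest_gammaStar hT hγ hper
  have hmin := isLeast_gammaStar hT hγ hper
  refine ⟨⟨hmax, hmin⟩, exists_hyperbolic_pair_of_discriminant_pos hT hγ hper,
    exists_semistable_double_of_discriminant_eq_zero hT hγ hper, ?_, fun p hp q hq => ⟨?_, ?_⟩⟩
  · rintro hΔ ⟨φ, hφ, -⟩
    exact hΔ.not_ge (hφ.discriminant_nonneg hT hγ hper)
  · exact sub_le_sub_right (hmax.2 ⟨p, hp, rfl⟩) _
  · exact sub_le_sub_right (hmin.2 ⟨q, hq, rfl⟩) _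

open RiccatiEq in
theorem mainTheorem2 (T : ℝ) (hT : 0 < T) (γ : ℝ → ℝ) (hγ : γ ∈ C1T T) :
    -- the maximum and the minimum that define `γ*` exist and coincide
    (IsGreatest (muLower T γ '' C1T T) (gammaStar T γ) ∧
      IsLeast (muUpper T γ '' C1T0 T) (gammaStar T γ)) ∧
    (0 < discriminant T γ →
      ∃ φ₁ φ₂ : ℝ → ℝ, φ₁ ≠ φ₂ ∧
        {φ | IsLimitCycle (riccati γ) T φ} = {φ₁, φ₂} ∧
        IsHyperbolic (riccati γ) T φ₁ ∧ IsHyperbolic (riccati γ) T φ₂) ∧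
    (discriminant T γ = 0 →
      ∃ φ : ℝ → ℝ, {ψ | IsLimitCycle (riccati γ) T ψ} = {φ} ∧
        IsSemistable (riccati γ) φ ∧ IsDouble (riccati γ) T φ) ∧
    (discriminant T γ < 0 → ¬ ∃ φ : ℝ → ℝ, IsLimitCycle (riccati γ) T φ) ∧
    (∀ p ∈ C1T T, ∀ q ∈ C1T0 T,
      muLower T γ p - mean T γ ≤ discriminant T γ ∧
        discriminant T γ ≤ muUpper T γ q - mean T γ) :=
  mainTheorem2_general T hT γ hγ.1.continuous hγ.2
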